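/- Let $K$ be an algebraically closed field of characteristic zero and let $n\ge 1$. The Waring rank $\operatorname{rk}(F)$ of a cubic form $F\in K[x_0,\dots,x_n]$ is the least $s$ such that $F=L_1^3+\dots+L_s^3$ for some linear forms $L_1,\dots,L_s\in K[x_0,\dots,x_n]$. A vertex of a form $Q$ is a point $v\in\mathbb P^n$ with $Q(x+tv)=Q(x)$ for all $x\in K^{n+1}$, $t\in K$, and $Q$ is a cone if it has a vertex. A hyperplane is tangent to the quadric $Q=0$ if it is the tangent hyperplane of the quadric at some smooth point of it. Let $F=LQ$ with $L\in K[x_0,\dots,x_n]$ a nonzero linear form and $Q\in K[x_0,\dots,x_n]$ a quadratic form. (A) If $Q$ is not a cone and the hyperplane $L=0$ is not tangent to $Q=0$, then $\operatorname{rk}(F)=2n$. (B) If $n\ge 2$, $Q$ is a cone and the hyperplane $L=0$ does not pass through any vertex of $Q$, then $\operatorname{rk}(F)=2n$. (C) If $Q$ is not a cone and the hyperplane $L=0$ is tangent to $Q=0$, then $2n\le \operatorname{rk}(F)\le 2n+1$. -/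

import Mathlib

namespace ReducibleCubic

variable {K : Type*} [Field K] {n : ℕ}

/-- The form `F` of degree `d` in the variables `x_0, …, x_n` is a sum of `s` `d`-th powers of
linear forms. -/
def IsSumOfPowers (d : ℕ) (F : MvPolynomial (Fin (n + 1)) K) (s : ℕ) : Prop :=
  ∃ L : Fin s → MvPolynomial (Fin (n + 1)) K,
    (∀ i, (L i).IsHomogeneous 1) ∧ F = ∑ i, L i ^ d

/-- The Waring rank of a form `F` of degree `d`: the least number of linear forms whose `d`-th
powers sum to `F` (and `⊤` if there is no such number). -/
noncomputable def waringRank (d : ℕ) (F : MvPolynomial (Fin (n + 1)) K) : ℕ∞ :=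
  ⨅ (s : ℕ) (_ : IsSumOfPowers d F s), (s : ℕ∞)

/-- The point of `ℙⁿ` with homogeneous coordinates `v` is a vertex of the hypersurface `F = 0`:
the form `F` is constant along the direction `v`. Since the fields considered here are infinite,
this means that in linear coordinates in which `v` is a basis vector, `F` does not involve the
coordinate belonging to `v`. -/
def IsVertex (F : MvPolynomial (Fin (n + 1)) K) (v : Fin (n + 1) → K) : Prop :=
  v ≠ 0 ∧ ∀ (x : Fin (n + 1) → K) (t : K),
    MvPolynomial.eval (x + t • v) F = MvPolynomial.eval x F

/-- The hypersurface `F = 0` in `ℙⁿ` is a cone: it has a vertex. -/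
def IsCone (F : MvPolynomial (Fin (n + 1)) K) : Prop :=
  ∃ v : Fin (n + 1) → K, IsVertex F v

/-- The differential of `Q` at `p`, the linear form `∑ i, (∂Q/∂x_i)(p) x_i`. If `p` is a smooth
point of `Q = 0`, its zero locus is the tangent hyperplane of `Q = 0` at `p`. -/
noncomputable def tangentForm (Q : MvPolynomial (Fin (n + 1)) K) (p : Fin (n + 1) → K) :
    MvPolynomial (Fin (n + 1)) K :=
  ∑ i, MvPolynomial.C (MvPolynomial.eval p (MvPolynomial.pderiv i Q)) * MvPolynomial.X i

/-- The hyperplane `L = 0` is tangent to the hypersurface `Q = 0`: it is the tangent hyperplane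
at some smooth point `p` of `Q = 0`. -/
def IsTangent (L Q : MvPolynomial (Fin (n + 1)) K) : Prop :=
  ∃ p : Fin (n + 1) → K, p ≠ 0 ∧ MvPolynomial.eval p Q = 0 ∧ tangentForm Q p ≠ 0 ∧
    ∃ c : K, c ≠ 0 ∧ L = MvPolynomial.C c * tangentForm Q p

/-- `F` is the product of the nonzero linear form `L` and the quadratic form `Q`. -/
def IsProduct (F L Q : MvPolynomial (Fin (n + 1)) K) : Prop :=
  L.IsHomogeneous 1 ∧ L ≠ 0 ∧ Q.IsHomogeneous 2 ∧ F = L * Q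

/-- Type A: `F = L Q`, where `Q` is not a cone and `L` is not tangent to `Q`. -/
def IsTypeA (F : MvPolynomial (Fin (n + 1)) K) : Prop :=
  ∃ L Q : MvPolynomial (Fin (n + 1)) K, IsProduct F L Q ∧ ¬ IsCone Q ∧ ¬ IsTangent L Q

/-- Type B: `F = L Q`, where `Q` is a cone and `L` does not pass through any vertex of `Q`. -/
def IsTypeB (F : MvPolynomial (Fin (n + 1)) K) : Prop :=
  ∃ L Q : MvPolynomial (Fin (n + 1)) K, IsProduct F L Q ∧ IsCone Q ∧
    ∀ v, IsVertex Q v → MvPolynomial.eval v L ≠ 0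

/-- Type C: `F = L Q`, where `Q` is not a cone and `L` is tangent to `Q`. -/
def IsTypeC (F : MvPolynomial (Fin (n + 1)) K) : Prop :=
  ∃ L Q : MvPolynomial (Fin (n + 1)) K, IsProduct F L Q ∧ ¬ IsCone Q ∧ IsTangent L Q

end ReducibleCubic

/-!
The proof is elementary linear algebra, carried out on the functions `L` and `q` on `K ^ (n + 1)`
defined by the two factors.

Lower bound (`two_mul_le_of_eq_sum_cubes`). Suppose `L * q = ∑ i, ℓ i ^ 3` with `r` summands. In
all three types no vertex of `q` lies on `L = 0`, so the cubic has no vertex (`no_vertex_mul`), and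
the `ℓ i` have no common zero; hence `n + 1` of them are linearly independent. If `r < 2 * n`, the
vanishing of `L` and of the remaining `r - n - 1 ≤ n - 2` forms leaves a subspace of dimension at
least two, which contains a nonzero zero `p` of `q`. The cubic is singular at `p`, so its gradient
`3 * ∑ i, ℓ i p ^ 2 • ℓ i` vanishes. This is a relation between the independent forms, and so every
`ℓ i` vanishes at `p`, a contradiction.

Upper bound. The identities `exists_two_cubes` and `exists_three_cubes` show that
`L * (m ^ 2 + c * L ^ 2)` with `c ≠ 0` is a sum of two cubes and `L ^ 2 * m` a sum of three. If `L`
is not tangent to the nondegenerate `q`, its pole splits off orthogonally and gives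
`q = ∑ i, m i ^ 2 + c * L ^ 2` with `n` squares and `c ≠ 0`; if `q` has a vertex off `L = 0`, the
same holds with `c = 0`. In both cases `c` is a sum of `n` nonzero scalars (for `c = 0` this needs
`n ≥ 2`), which gives `2 * n` cubes (`exists_cubes_of_complement`). If `L` is tangent, its pole lies
in the radical of the restriction of `q` to `L = 0`, so that `q = ∑ i, m i ^ 2 + L * g` with `n - 1`
squares and a linear form `g`, which gives `2 * (n - 1) + 3` cubes
(`exists_cubes_of_isotropic_pole`).
-/

namespace ReducibleCubic

open MvPolynomial Module

/-! ### Cubics `L * q` as functions on a vector space -/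

section Functions

variable {K V : Type*} [Field K] [AddCommGroup V] [Module K V]

theorem map_add_smul (q : QuadraticForm K V) (x v : V) (t : K) :
    q (x + t • v) = q x + t * QuadraticMap.polar q x v + t * t * q v := by
  rw [QuadraticMap.map_add (q : V → K), QuadraticMap.map_smul, QuadraticMap.polar_smul_right]
  simp only [smul_eq_mul]
  ring

theorem exists_isotropic [IsAlgClosed K] (q : QuadraticForm K V) {x y : V}
    (hxy : LinearIndependent K ![x, y]) :
    ∃ s t : K, s • x + t • y ≠ 0 ∧ q (s • x + t • y) = 0 := by
  rw [LinearIndependent.pair_iff] at hxy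
  by_cases hy : q y = 0
  · refine ⟨0, 1, fun h => one_ne_zero (hxy 0 1 h).2, by simpa using hy⟩
  · obtain ⟨t, ht⟩ := IsAlgClosed.exists_root
      (Polynomial.C (q y) * Polynomial.X ^ 2 + Polynomial.C (QuadraticMap.polar q x y)
        * Polynomial.X + Polynomial.C (q x)) (by
          rw [Polynomial.degree_quadratic hy]; decide)
    refine ⟨1, t, fun h => one_ne_zero (hxy 1 t h).1, ?_⟩
    simp only [Polynomial.IsRoot.def, Polynomial.eval_add, Polynomial.eval_mul,
      Polynomial.eval_C, Polynomial.eval_pow, Polynomial.eval_X] at ht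
    rw [one_smul, map_add_smul]
    linear_combination ht

theorem exists_ne_zero_mem_ker [FiniteDimensional K V] (hV : 2 ≤ finrank K V) (L : Dual K V) :
    ∃ w : V, w ≠ 0 ∧ L w = 0 := by
  have h := L.finrank_range_add_finrank_ker
  have h1 : finrank K (LinearMap.range L) ≤ 1 := by
    simpa using Submodule.finrank_le (LinearMap.range L)
  obtain ⟨w, hw⟩ := Module.finrank_pos_iff_exists_ne_zero.1
    (show 0 < finrank K (LinearMap.ker L) by omega)
  exact ⟨w, fun h => hw (Subtype.ext h), w.2⟩

/-- If no vertex of `q` lies on the hyperplane `L = 0`, then the cubic `L * q` has no vertex at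
all. -/
theorem no_vertex_mul [CharZero K] [FiniteDimensional K V] (hV : 2 ≤ finrank K V)
    (q : QuadraticForm K V) {L : Dual K V} (hL : L ≠ 0)
    (hq : ∀ v : V, v ≠ 0 → (∀ (x : V) (t : K), q (x + t • v) = q x) → L v ≠ 0)
    {v : V} (hv : ∀ (x : V) (t : K), L (x + t • v) * q (x + t • v) = L x * q x) : v = 0 := by
  by_contra hv0
  simp only [map_add_smul, map_add, map_smul, smul_eq_mul] at hv hq
  obtain ⟨x₀, hx₀⟩ : ∃ x, L x ≠ 0 := by
    by_contra! h
    exact hL (LinearMap.ext h)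
  by_cases hLv : L v = 0
  · have key : ∀ x, L x ≠ 0 → QuadraticMap.polar q x v = 0 ∧ q v = 0 := by
      intro x hx
      have h1 := hv x 1
      have h2 := hv x (-1)
      rw [hLv] at h1 h2
      constructor
      · apply mul_left_cancel₀ (mul_ne_zero two_ne_zero hx)
        linear_combination h1 - h2
      · apply mul_left_cancel₀ (mul_ne_zero two_ne_zero hx)
        linear_combination h1 + h2
    refine hq v hv0 (fun x t => ?_) hLv
    rw [(key x₀ hx₀).2]
    suffices QuadraticMap.polar q x v = 0 by rw [this]; ring
    by_cases hx : L x = 0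
    · have := (key (x + x₀) (by simpa [hx] using hx₀)).1
      rwa [QuadraticMap.polar_add_left, (key x₀ hx₀).1, add_zero] at this
    · exact (key x hx).1
  · -- Moving `x` along `v` into the hyperplane `L = 0` shows `L x * q x = 0`, hence `q = 0`.
    have key : ∀ x, L x * q x = 0 := by
      intro x
      rw [← hv x (-(L x / L v))]
      have : L x + -(L x / L v) * L v = 0 := by field_simp; ring
      rw [this, zero_mul]
    have hqv : q v = 0 := (mul_eq_zero.1 (key v)).resolve_left hLv
    have hq0 : ∀ x, q x = 0 := by
      intro x
      by_cases hx : L x = 0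
      · have h1 := key (x + (1 : K) • v)
        have h2 := key (x + (-1 : K) • v)
        simp only [map_add_smul, map_add, map_smul, smul_eq_mul, hx, hqv] at h1 h2
        apply mul_left_cancel₀ (mul_ne_zero two_ne_zero hLv)
        linear_combination h1 - h2
      · exact (mul_eq_zero.1 (key x)).resolve_left hx
    -- Now every vector is a vertex of `q`, also those of the hyperplane `L = 0`.
    obtain ⟨w, hw0, hw⟩ := exists_ne_zero_mem_ker hV L
    refine hq w hw0 (fun x t => ?_) hw
    simp [hq0, QuadraticMap.polar]

/-- The gradient of a cubic `L * q = ∑ i, ℓ i ^ 3` vanishes at the common zeros of `L` and `q`. -/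
theorem sum_sq_mul_eq_zero [CharZero K] {ι : Type*} [Fintype ι] (q : QuadraticForm K V)
    (L : Dual K V) (ℓ : ι → Dual K V) (h : ∀ x, L x * q x = ∑ i, ℓ i x ^ 3)
    {p : V} (hLp : L p = 0) (hqp : q p = 0) (x : V) : ∑ i, ℓ i p ^ 2 * ℓ i x = 0 := by
  have expand : ∀ t : K, t * L x * (t * QuadraticMap.polar q p x + t * t * q x) =
      ∑ i, ℓ i p ^ 3 + 3 * t * ∑ i, ℓ i p ^ 2 * ℓ i x + 3 * t ^ 2 * ∑ i, ℓ i p * ℓ i x ^ 2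
        + t ^ 3 * ∑ i, ℓ i x ^ 3 := by
    intro t
    have := h (p + t • x)
    simp only [map_add_smul, map_add, map_smul, smul_eq_mul, hLp, hqp] at this
    simp only [zero_add] at this
    rw [this]
    simp only [Finset.mul_sum, ← Finset.sum_add_distrib]
    exact Finset.sum_congr rfl fun i _ => by ring
  have h0 := expand 0
  have h1 := expand 1
  have h2 := expand (-1)
  have h3 := expand 2
  apply mul_left_cancel₀ (show (18 : K) ≠ 0 by norm_num)
  linear_combination 3 * h0 - 6 * h1 + 2 * h2 + h3

/-- A cubic `L * q` without vertices on a space of dimension `n + 1` is not a sum of fewer than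
`2 * n` cubes: otherwise the singular locus `L = q = 0` contains a nonzero point at which all the
cubed linear forms vanish. -/
theorem two_mul_le_of_eq_sum_cubes [IsAlgClosed K] [CharZero K] [FiniteDimensional K V] {n r : ℕ}
    (hV : finrank K V = n + 1) (q : QuadraticForm K V) (L : Dual K V)
    (hF : ∀ v : V, (∀ (x : V) (t : K), L (x + t • v) * q (x + t • v) = L x * q x) → v = 0)
    (ℓ : Fin r → Dual K V) (h : ∀ x, L x * q x = ∑ i, ℓ i x ^ 3) : 2 * n ≤ r := by
  classical
  have hℓ : ∀ v, (∀ i, ℓ i v = 0) → v = 0 := by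
    intro v hv
    apply hF
    intro x t
    rw [h, h]
    simp [hv]
  obtain ⟨κ, a, ha, hspan, hli⟩ := exists_linearIndependent' K ℓ
  have hfin : Finite κ := Finite.of_injective a ha
  have := Fintype.ofFinite κ
  -- The common zeros of the independent subfamily are those of the whole family.
  have hκ : ∀ v, (∀ k, ℓ (a k) v = 0) → v = 0 := by
    intro v hv
    apply hℓ
    intro i
    have hi : ℓ i ∈ Submodule.span K (Set.range (ℓ ∘ a)) := by
      rw [hspan]; exact Submodule.subset_span ⟨i, rfl⟩
    have hle : Submodule.span K (Set.range (ℓ ∘ a)) ≤ LinearMap.ker (Dual.eval K V v) := by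
      rw [Submodule.span_le]
      rintro _ ⟨k, rfl⟩
      exact hv k
    exact hle hi
  have hcard : n + 1 ≤ Fintype.card κ := by
    have hinj : Function.Injective (LinearMap.pi fun k => ℓ (a k)) := by
      rw [injective_iff_map_eq_zero]
      intro v hv
      exact hκ v fun k => congrFun hv k
    have := LinearMap.finrank_le_finrank_of_injective hinj
    rwa [hV, Module.finrank_fintype_fun_eq_card] at this
  by_contra! hr
  -- The section of `L = 0` by the forms outside the independent subfamily has dimension at least
  -- two, so it contains a nonzero isotropic vector `p` of `q`.
  let I := {i : Fin r // i ∉ Set.range a}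
  have hI : Fintype.card I + Fintype.card κ = r := by
    have h1 : Fintype.card {i : Fin r // i ∈ Set.range a} = Fintype.card κ :=
      Set.card_range_of_injective ha
    have h2 := Fintype.card_subtype_compl (fun i : Fin r => i ∈ Set.range a)
    have h3 := Fintype.card_subtype_le (fun i : Fin r => i ∈ Set.range a)
    rw [Fintype.card_fin] at h2 h3
    change Fintype.card I = _ at h2
    omega
  let f : V →ₗ[K] K × (I → K) := L.prod (LinearMap.pi fun i : I => ℓ i)
  have hker : 2 ≤ finrank K (LinearMap.ker f) := by
    have h1 := f.finrank_range_add_finrank_ker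
    have h2 := Submodule.finrank_le (LinearMap.range f)
    rw [Module.finrank_prod, Module.finrank_self, Module.finrank_fintype_fun_eq_card] at h2
    omega
  obtain ⟨g, hg⟩ := exists_linearIndependent_of_le_finrank hker
  have hg' : LinearIndependent K ![(g 0 : V), (g 1 : V)] := by
    have h1 := hg.map' (LinearMap.ker f).subtype (Submodule.ker_subtype _)
    have h2 : (LinearMap.ker f).subtype ∘ g = ![(g 0 : V), (g 1 : V)] := by
      ext i
      fin_cases i <;> rfl
    rwa [h2] at h1
  obtain ⟨s, t, hp0, hqp⟩ := exists_isotropic q hg'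
  set p : V := s • (g 0 : V) + t • (g 1 : V) with hp
  have hpf : f p = 0 := by
    have h0 : f (g 0) = 0 := (g 0).2
    have h1 : f (g 1) = 0 := (g 1).2
    rw [hp, map_add, map_smul, map_smul, h0, h1, smul_zero, smul_zero, add_zero]
  have hLp : L p = 0 := congrArg Prod.fst hpf
  have hIp : ∀ i ∉ Set.range a, ℓ i p = 0 := fun i hi => congrFun (congrArg Prod.snd hpf) ⟨i, hi⟩
  apply hp0
  apply hκ
  -- At `p` the vanishing gradient is a linear relation between the independent forms `ℓ (a k)`.
  have hrel : ∑ k, ℓ (a k) p ^ 2 • (ℓ ∘ a) k = 0 := by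
    ext x
    rw [LinearMap.zero_apply, ← sum_sq_mul_eq_zero q L ℓ h hLp hqp x, LinearMap.sum_apply]
    refine Fintype.sum_of_injective a ha _ _ (fun i hi => ?_) fun k => ?_
    · rw [hIp i hi]; ring
    · simp
  intro k
  exact pow_eq_zero_iff two_ne_zero |>.1 (Fintype.linearIndependent_iff.1 hli _ hrel k)

/-- A quadratic form composed with an endomorphism whose kernel contains `k` independent vectors
is a sum of at most `dim V - k` squares of linear forms. -/
theorem exists_sum_sq_comp [IsAlgClosed K] [CharZero K] [FiniteDimensional K V]
    (q : QuadraticForm K V) (P : V →ₗ[K] V) {k d : ℕ} (f : Fin k → V)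
    (hf : LinearIndependent K f) (hP : ∀ i, P (f i) = 0) (hd : finrank K V ≤ d + k) :
    ∃ ℓ : Fin d → Dual K V, ∀ x, q (P x) = ∑ i, ℓ i x ^ 2 := by
  have hk : k ≤ finrank K (LinearMap.ker P) := by
    have := (LinearIndependent.of_comp (LinearMap.ker P).subtype
      (v := fun i => (⟨f i, hP i⟩ : LinearMap.ker P)) hf).fintype_card_le_finrank
    simpa using this
  have h1 := P.finrank_range_add_finrank_ker
  let W := LinearMap.range P
  obtain ⟨e, he⟩ := Nat.exists_eq_add_of_le (show finrank K W ≤ d by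
    change finrank K (LinearMap.range P) ≤ d; omega)
  have : Invertible (2 : K) := invertibleOfNonzero two_ne_zero
  obtain ⟨w, ⟨φ⟩⟩ := 
    QuadraticForm.equivalent_weightedSumSquares (q.comp W.subtype)
  choose b hb using fun i => IsAlgClosed.exists_pow_nat_eq (w i) two_pos
  let m : Fin (finrank K W) → Dual K V := fun i =>
    b i • (LinearMap.proj i ∘ₗ φ.toLinearEquiv.toLinearMap ∘ₗ P.rangeRestrict)
  subst he
  refine ⟨Fin.append m 0, fun x => ?_⟩
  have hx := φ.map_app (P.rangeRestrict x)
  rw [QuadraticMap.weightedSumSquares_apply] at hx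
  rw [Fin.sum_univ_add]
  simp only [Fin.append_left, Fin.append_right, Pi.zero_apply, LinearMap.zero_apply]
  have hz : ∑ _i : Fin e, (0 : K) ^ 2 = 0 := by simp
  rw [hz, add_zero]
  change q (P x) = _
  refine Eq.trans hx.symm (Finset.sum_congr rfl fun i _ => ?_)
  simp only [m, smul_eq_mul, LinearMap.smul_apply, mul_pow, hb]
  rw [sq (_ : K)]
  rfl

/-- The product `L * (m ^ 2 + c * L ^ 2)` with `c ≠ 0` is a sum of two cubes. -/
theorem exists_two_cubes [IsAlgClosed K] [CharZero K] (L m : Dual K V) {c : K} (hc : c ≠ 0) :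
    ∃ ℓ : Bool → Dual K V, ∀ x, L x * (m x ^ 2 + c * L x ^ 2) = ∑ b, ℓ b x ^ 3 := by
  obtain ⟨a, ha⟩ := IsAlgClosed.exists_pow_nat_eq (c / 2) three_pos
  have ha0 : a ≠ 0 := by
    rintro rfl
    exact hc (by linear_combination -2 * ha)
  obtain ⟨b, hb⟩ := IsAlgClosed.exists_pow_nat_eq (1 / (6 * a)) two_pos
  have hb' : 6 * a * b ^ 2 = 1 := by rw [hb]; field_simp
  have ha' : 2 * a ^ 3 = c := by rw [ha]; field_simp
  refine ⟨fun s => bif s then a • L + b • m else a • L - b • m, fun x => ?_⟩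
  simp only [Fintype.sum_bool, cond_true, cond_false, LinearMap.add_apply, LinearMap.sub_apply,
    LinearMap.smul_apply, smul_eq_mul]
  linear_combination -(L x * m x ^ 2) * hb' - L x ^ 3 * ha'

/-- The product `L ^ 2 * m` is a sum of three cubes. -/
theorem exists_three_cubes [IsAlgClosed K] [CharZero K] (L m : Dual K V) :
    ∃ ℓ : Fin 3 → Dual K V, ∀ x, L x ^ 2 * m x = ∑ i, ℓ i x ^ 3 := by
  obtain ⟨a, ha⟩ := IsAlgClosed.exists_pow_nat_eq (1 / 6 : K) three_pos
  obtain ⟨b, hb⟩ := IsAlgClosed.exists_pow_nat_eq (-1 / 3 : K) three_pos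
  refine ⟨![a • (m + L), a • (m - L), b • m], fun x => ?_⟩
  simp only [Fin.sum_univ_three, Matrix.cons_val, LinearMap.add_apply, LinearMap.sub_apply,
    LinearMap.smul_apply, smul_eq_mul, mul_pow, ha, hb]
  ring

/-- A prescribed sum of `n ≥ 1` nonzero scalars, except that a single one cannot vanish. -/
theorem exists_ne_zero_sum_eq [CharZero K] {n : ℕ} (hn : 1 ≤ n) (c : K) (hc : c ≠ 0 ∨ 2 ≤ n) :
    ∃ d : Fin n → K, (∀ i, d i ≠ 0) ∧ ∑ i, d i = c := by
  obtain ⟨m, rfl⟩ := Nat.exists_eq_add_of_le' hn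
  obtain ⟨t, ht, htc⟩ : ∃ t : K, t ≠ 0 ∧ c - m * t ≠ 0 := by
    by_cases h1 : c - m * 1 = 0
    · refine ⟨2, two_ne_zero, fun h2 => ?_⟩
      have hm : (m : K) = 0 := by linear_combination h1 - h2
      rcases hc with hc | hc
      · exact hc (by linear_combination h1 + hm)
      · have : m = 0 := by exact_mod_cast hm
        omega
    · exact ⟨1, one_ne_zero, h1⟩
  refine ⟨Fin.cons (c - m * t) fun _ => t, fun i => ?_, ?_⟩
  · refine Fin.cases ?_ (fun j => ?_) i
    · simpa using htc
    · simpa using ht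
  · rw [Fin.sum_univ_succ]
    simp

/-- Distributing the multiple `∑ i, d i` of `L ^ 2` over the `n` squares `m i ^ 2` makes
`L * (∑ i, m i ^ 2 + (∑ i, d i) * L ^ 2)` a sum of `2 * n` cubes. -/
theorem exists_cubes_of_sum_sq [IsAlgClosed K] [CharZero K] {n : ℕ} (L : Dual K V)
    (m : Fin n → Dual K V) (d : Fin n → K) (hd : ∀ i, d i ≠ 0) :
    ∃ ℓ : Fin n × Bool → Dual K V,
      ∀ x, L x * (∑ i, m i x ^ 2 + (∑ i, d i) * L x ^ 2) = ∑ i, ℓ i x ^ 3 := by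
  choose ℓ hℓ using fun i => exists_two_cubes L (m i) (hd i)
  refine ⟨fun i => ℓ i.1 i.2, fun x => ?_⟩
  rw [Fintype.sum_prod_type, Finset.sum_mul, ← Finset.sum_add_distrib, Finset.mul_sum]
  exact Finset.sum_congr rfl fun i _ => hℓ i x

/-- The case in which `q` splits orthogonally along a line `K v` transversal to the hyperplane
`L = 0`: the restriction of `q` to the hyperplane is a sum of `n` squares. -/
theorem exists_cubes_of_complement [IsAlgClosed K] [CharZero K] [FiniteDimensional K V] {n : ℕ}
    (hn : 1 ≤ n) (hV : finrank K V = n + 1) (q : QuadraticForm K V) (L : Dual K V) {v : V}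
    (hv : L v = 1) (c : K) (hc : c ≠ 0 ∨ 2 ≤ n)
    (hq : ∀ x, q x = c * L x ^ 2 + q (x - L x • v)) :
    ∃ ℓ : Fin n × Bool → Dual K V, ∀ x, L x * q x = ∑ i, ℓ i x ^ 3 := by
  have hv0 : v ≠ 0 := by rintro rfl; simp at hv
  obtain ⟨m, hm⟩ := exists_sum_sq_comp (d := n) q (LinearMap.id - L.smulRight v) ![v]
    (by simpa using hv0) (by intro i; fin_cases i; simp [hv]) hV.le
  obtain ⟨d, hd, rfl⟩ := exists_ne_zero_sum_eq hn c hc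
  obtain ⟨ℓ, hℓ⟩ := exists_cubes_of_sum_sq L m d hd
  refine ⟨ℓ, fun x => ?_⟩
  have := hm x
  simp only [LinearMap.sub_apply, LinearMap.id_apply, LinearMap.smulRight_apply] at this
  rw [← hℓ, hq, this, add_comm]

/-- The tangent case: `v` is in the radical of the restriction of `q` to the hyperplane `L = 0`,
which is therefore a sum of only `n - 1` squares. Hence `q = ∑ i, m i ^ 2 + L * g` for some linear
form `g`, and `L ^ 2 * g` costs three more cubes. -/
theorem exists_cubes_of_isotropic_pole [IsAlgClosed K] [CharZero K] [FiniteDimensional K V]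
    {n : ℕ} (hn : 1 ≤ n) (hV : finrank K V = n + 1) (q : QuadraticForm K V) {L : Dual K V}
    (hL : L ≠ 0) {v : V} (hv0 : v ≠ 0) (hqv : q v = 0) (hLv : L v = 0)
    (hv : ∀ x, L x = 0 → QuadraticMap.polar q x v = 0) :
    ∃ ℓ : (Fin (n - 1) × Bool) ⊕ Fin 3 → Dual K V, ∀ x, L x * q x = ∑ i, ℓ i x ^ 3 := by
  obtain ⟨μ, hμ⟩ := Projective.exists_dual_eq_one K hv0
  obtain ⟨u, hLu, hμu⟩ : ∃ u, L u = 1 ∧ μ u = 0 := by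
    obtain ⟨x, hx⟩ : ∃ x, L x ≠ 0 := by
      by_contra! h
      exact hL (LinearMap.ext h)
    refine ⟨(L x)⁻¹ • (x - μ x • v), ?_, ?_⟩
    · simp [hLv, hx]
    · simp [hμ]
  have hli : LinearIndependent K ![u, v] := by
    rw [LinearIndependent.pair_iff]
    intro s t hst
    have h1 := congrArg L hst
    have h2 := congrArg μ hst
    simp only [map_add, map_smul, hLu, hLv, hμ, hμu, smul_eq_mul, map_zero] at h1 h2
    constructor
    · linear_combination h1
    · linear_combination h2
  obtain ⟨m, hm⟩ := exists_sum_sq_comp (d := n - 1) q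
    (LinearMap.id - L.smulRight u - μ.smulRight v) ![u, v] hli
    (by intro i; fin_cases i <;> simp [hLu, hLv, hμ, hμu]) (by omega)
  obtain ⟨ℓ₁, hℓ₁⟩ := exists_cubes_of_sum_sq L m (fun _ => 1) fun _ => one_ne_zero
  obtain ⟨g, hg⟩ : ∃ g : Dual K V, ∀ x, q x = ∑ i, m i x ^ 2 + L x * g x := by
    refine ⟨q u • L + (q.polarBilin u) ∘ₗ (LinearMap.id - L.smulRight u), fun x => ?_⟩
    rw [← hm]
    simp only [LinearMap.sub_apply, LinearMap.id_apply, LinearMap.smulRight_apply,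
      LinearMap.add_apply, LinearMap.smul_apply, LinearMap.comp_apply,
      QuadraticMap.polarBilin_apply_apply, smul_eq_mul]
    set y := x - L x • u with hy
    have hLy : L y = 0 := by simp [hy, hLu]
    have hx : x = y + L x • u := by rw [hy]; abel
    have h1 : q (y - μ x • v) = q y := by
      rw [sub_eq_add_neg, ← neg_smul, map_add_smul, hv y hLy, hqv]; ring
    have h2 : q x = q y + L x * QuadraticMap.polar q y u + L x * L x * q u := by
      conv_lhs => rw [hx]
      exact map_add_smul q y u (L x)
    rw [h1, h2, QuadraticMap.polar_comm q u y]
    ring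
  -- `g` is corrected for the summands `L ^ 3` that the products `L * m i ^ 2` borrow.
  obtain ⟨ℓ₂, hℓ₂⟩ := exists_three_cubes L (g - (∑ _i : Fin (n - 1), (1 : K)) • L)
  refine ⟨Sum.elim ℓ₁ ℓ₂, fun x => ?_⟩
  rw [Fintype.sum_sum_type]
  simp only [Sum.elim_inl, Sum.elim_inr]
  rw [← hℓ₁, ← hℓ₂, hg]
  simp only [LinearMap.sub_apply, LinearMap.smul_apply, smul_eq_mul]
  ring

end Functions

/-! ### From forms to functions, and the bounds on the Waring rank -/

section Polynomials

variable {K : Type*} [Field K] {n : ℕ}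

/-- Euler's identity for a linear form. -/
theorem linear_eq_sum {L : MvPolynomial (Fin (n + 1)) K} (hL : L.IsHomogeneous 1) :
    L = ∑ i, C (coeff 0 (pderiv i L)) * X i := by
  have h := hL.sum_X_mul_pderiv
  rw [one_smul] at h
  conv_lhs => rw [← h]
  refine Finset.sum_congr rfl fun i _ => ?_
  have h0 : (pderiv i L).IsHomogeneous 0 := hL.pderiv
  conv_lhs => rw [totalDegree_eq_zero_iff_eq_C.1 (Nat.le_zero.1 h0.totalDegree_le)]
  rw [mul_comm]

theorem exists_dual {L : MvPolynomial (Fin (n + 1)) K} (hL : L.IsHomogeneous 1) :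
    ∃ ℓ : Dual K (Fin (n + 1) → K), ∀ x, eval x L = ℓ x := by
  refine ⟨∑ i, coeff 0 (pderiv i L) • LinearMap.proj i, fun x => ?_⟩
  conv_lhs => rw [linear_eq_sum hL]
  simp

theorem exists_linear (ℓ : Dual K (Fin (n + 1) → K)) :
    ∃ L : MvPolynomial (Fin (n + 1)) K, L.IsHomogeneous 1 ∧ ∀ x, eval x L = ℓ x := by
  refine ⟨∑ i, C (ℓ fun j => if i = j then 1 else 0) * X i,
    IsHomogeneous.sum _ _ _ fun i _ => isHomogeneous_C_mul_X _ _, fun x => ?_⟩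
  rw [LinearMap.pi_apply_eq_sum_univ ℓ x]
  simp [mul_comm]

/-- A form of degree two is a quadratic form, and its differential at `p` is the polar form
`polar q p`. -/
theorem exists_quadraticForm [CharZero K] {Q : MvPolynomial (Fin (n + 1)) K}
    (hQ : Q.IsHomogeneous 2) :
    ∃ q : QuadraticForm K (Fin (n + 1) → K), (∀ x, eval x Q = q x) ∧
      ∀ p x, eval x (tangentForm Q p) = QuadraticMap.polar q p x := by
  obtain ⟨B, rfl⟩ : ∃ B : Fin (n + 1) → Fin (n + 1) → K,
      Q = ∑ i, ∑ j, C (B i j) * (X i * X j) := by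
    refine ⟨fun i j => 2⁻¹ * coeff 0 (pderiv j (pderiv i Q)), ?_⟩
    have h := hQ.sum_X_mul_pderiv
    have h2 : Q = C (2⁻¹ : K) * (2 • Q) := by
      rw [nsmul_eq_mul, Nat.cast_ofNat, ← mul_assoc, ← map_ofNat C 2, ← C_mul]
      simp
    conv_lhs => rw [h2, ← h, Finset.mul_sum]
    refine Finset.sum_congr rfl fun i _ => ?_
    have h1 : (pderiv i Q).IsHomogeneous 1 := hQ.pderiv
    conv_lhs => rw [linear_eq_sum h1]
    rw [Finset.mul_sum, Finset.mul_sum]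
    refine Finset.sum_congr rfl fun j _ => ?_
    rw [C_mul]
    ring
  refine ⟨(Matrix.toBilin' (Matrix.of B)).toQuadraticMap, fun x => ?_, fun p x => ?_⟩
  · rw [LinearMap.BilinMap.toQuadraticMap_apply, Matrix.toBilin'_apply]
    simp only [map_sum, map_mul, eval_C, eval_X, Matrix.of_apply]
    exact Finset.sum_congr rfl fun i _ => Finset.sum_congr rfl fun j _ => by ring
  · rw [LinearMap.BilinMap.polar_toQuadraticMap, Matrix.toBilin'_apply, Matrix.toBilin'_apply,
      tangentForm]
    have hd : ∀ k, eval p (pderiv k (∑ i, ∑ j, C (B i j) * (X i * X j))) =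
        ∑ j, B k j * p j + ∑ i, B i k * p i := by
      intro k
      have ht : ∀ i j, eval p (pderiv k (C (B i j) * (X i * X j))) =
          (if i = k then B i j * p j else 0) + if j = k then B i j * p i else 0 := by
        intro i j
        rw [pderiv_C_mul, pderiv_mul, pderiv_X, pderiv_X]
        simp only [Pi.single_apply]
        split_ifs <;> simp; ring
      simp only [map_sum, ht, Finset.sum_add_distrib]
      congr 1
      · rw [Finset.sum_comm]
        simp
      · simp
    rw [map_sum]
    simp only [map_mul, eval_C, eval_X, hd, add_mul, Finset.sum_add_distrib, Finset.sum_mul,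
      Matrix.of_apply]
    rw [add_comm]
    congr 1
    · rw [Finset.sum_comm]
      exact Finset.sum_congr rfl fun i _ => Finset.sum_congr rfl fun j _ => by ring
    · exact Finset.sum_congr rfl fun i _ => Finset.sum_congr rfl fun j _ => by ring

theorem waringRank_le_card [CharZero K] {F : MvPolynomial (Fin (n + 1)) K} {ι : Type*} [Fintype ι]
    (ℓ : ι → Dual K (Fin (n + 1) → K)) (d : ℕ) (h : ∀ x, eval x F = ∑ i, ℓ i x ^ d) :
    waringRank d F ≤ (Fintype.card ι : ℕ∞) := by
  refine iInf₂_le (Fintype.card ι) ?_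
  choose L hL hLe using fun i => exists_linear (ℓ i)
  refine ⟨fun k => L ((Fintype.equivFin ι).symm k), fun k => hL _, ?_⟩
  rw [Equiv.sum_comp (Fintype.equivFin ι).symm fun i => L i ^ d]
  apply MvPolynomial.funext
  intro x
  simp [h, hLe]

/-- The lower bound: it only requires that no vertex of `Q` lies on the hyperplane `L = 0`. -/
theorem two_mul_le_waringRank [IsAlgClosed K] [CharZero K] (hn : 1 ≤ n)
    {F L Q : MvPolynomial (Fin (n + 1)) K} (hF : IsProduct F L Q)
    (hv : ∀ v, IsVertex Q v → eval v L ≠ 0) :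
    ((2 * n : ℕ) : ℕ∞) ≤ waringRank 3 F := by
  obtain ⟨hL, hL0, hQ, rfl⟩ := hF
  refine le_iInf₂ fun s hs => ?_
  obtain ⟨M, hM, hsum⟩ := hs
  obtain ⟨l, hl⟩ := exists_dual hL
  obtain ⟨q, hq, -⟩ := exists_quadraticForm hQ
  choose m hm using fun i => exists_dual (hM i)
  have hl0 : l ≠ 0 := by
    rintro rfl
    exact hL0 (MvPolynomial.funext fun x => by simp [hl])
  have hfin : finrank K (Fin (n + 1) → K) = n + 1 := by simp
  refine Nat.cast_le.2 (two_mul_le_of_eq_sum_cubes hfin q l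
    (fun v => no_vertex_mul (by omega) q hl0 fun v hv0 h => ?_) m fun x => ?_)
  · rw [← hl]
    exact hv v ⟨hv0, fun x t => by rw [hq, hq, h]⟩
  · rw [← hl, ← hq, ← map_mul, hsum]
    simp [hm]

/-- The polarity of a quadric that is not a cone: every linear form is `polar q v` for some
pole `v`. -/
theorem exists_pole [CharZero K] {Q : MvPolynomial (Fin (n + 1)) K} (hQ : ¬ IsCone Q)
    {q : QuadraticForm K (Fin (n + 1) → K)} (hq : ∀ x, eval x Q = q x)
    (l : Dual K (Fin (n + 1) → K)) : ∃ v, ∀ x, l x = QuadraticMap.polar q v x := by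
  have hinj : Function.Injective q.polarBilin := by
    rw [injective_iff_map_eq_zero]
    intro v hv
    by_contra hv0
    refine hQ ⟨v, hv0, fun x t => ?_⟩
    have h1 : ∀ x, QuadraticMap.polar q v x = 0 := fun x => LinearMap.congr_fun hv x
    have h2 : q v = 0 := by
      have := h1 v
      rw [QuadraticMap.polar_self] at this
      simpa using this
    rw [hq, hq, map_add_smul, h2, QuadraticMap.polar_comm, h1]
    ring
  have hsurj := (LinearMap.injective_iff_surjective_of_finrank_eq_finrank
    (Subspace.dual_finrank_eq (K := K) (V := Fin (n + 1) → K)).symm).1 hinj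
  obtain ⟨v, hv⟩ := hsurj l
  exact ⟨v, fun x => by rw [← hv]; rfl⟩

theorem waringRank_le_of_typeA [IsAlgClosed K] [CharZero K] (hn : 1 ≤ n)
    {F : MvPolynomial (Fin (n + 1)) K} (h : IsTypeA F) :
    waringRank 3 F ≤ ((2 * n : ℕ) : ℕ∞) := by
  obtain ⟨L, Q, ⟨hL, hL0, hQ, rfl⟩, hcone, htan⟩ := h
  obtain ⟨l, hl⟩ := exists_dual hL
  obtain ⟨q, hq, hqt⟩ := exists_quadraticForm hQ
  obtain ⟨v, hv⟩ := exists_pole hcone hq l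
  have hLt : L = tangentForm Q v := MvPolynomial.funext fun x => by rw [hl, hqt, hv]
  have hv0 : v ≠ 0 := by
    rintro rfl
    exact hL0 (MvPolynomial.funext fun x => by rw [hl, hv, QuadraticMap.polar_zero_left, map_zero])
  have hqv : q v ≠ 0 := fun h0 =>
    htan ⟨v, hv0, by rw [hq, h0], hLt ▸ hL0, 1, one_ne_zero, by rw [C_1, one_mul, ← hLt]⟩
  have hlv : l v = 2 * q v := by rw [hv, QuadraticMap.polar_self]; simp
  have hlv0 : l v ≠ 0 := by rw [hlv]; exact mul_ne_zero two_ne_zero hqv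
  obtain ⟨ℓ, hℓ⟩ := exists_cubes_of_complement hn (by simp) q l (v := (l v)⁻¹ • v)
    (by simp [hlv0]) (q v / l v ^ 2) (Or.inl (div_ne_zero hqv (pow_ne_zero 2 hlv0))) (by
      intro x
      have hx : x = (x - l x • (l v)⁻¹ • v) + (l x * (l v)⁻¹) • v := by
        rw [smul_smul]; abel
      conv_lhs => rw [hx]
      rw [map_add_smul, QuadraticMap.polar_comm, ← hv]
      simp only [map_sub, map_smul, smul_eq_mul]
      field_simp
      ring)
  refine (waringRank_le_card ℓ 3 fun x => ?_).trans (by simp [mul_comm])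
  rw [map_mul, hl, hq, hℓ]

theorem waringRank_le_of_typeB [IsAlgClosed K] [CharZero K] (hn : 2 ≤ n)
    {F : MvPolynomial (Fin (n + 1)) K} (h : IsTypeB F) :
    waringRank 3 F ≤ ((2 * n : ℕ) : ℕ∞) := by
  obtain ⟨L, Q, ⟨hL, hL0, hQ, rfl⟩, ⟨v, hv⟩, hlv⟩ := h
  obtain ⟨l, hl⟩ := exists_dual hL
  obtain ⟨q, hq, -⟩ := exists_quadraticForm hQ
  have hlv0 : l v ≠ 0 := by rw [← hl]; exact hlv v hv
  obtain ⟨ℓ, hℓ⟩ := exists_cubes_of_complement (by omega) (by simp) q l (v := (l v)⁻¹ • v)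
    (by simp [hlv0]) 0 (Or.inr hn) (by
      intro x
      rw [smul_smul, sub_eq_add_neg, ← neg_smul, ← hq, ← hq, hv.2]
      ring)
  refine (waringRank_le_card ℓ 3 fun x => ?_).trans (by simp [mul_comm])
  rw [map_mul, hl, hq, hℓ]

theorem waringRank_le_of_typeC [IsAlgClosed K] [CharZero K] (hn : 1 ≤ n)
    {F : MvPolynomial (Fin (n + 1)) K} (h : IsTypeC F) :
    waringRank 3 F ≤ ((2 * n + 1 : ℕ) : ℕ∞) := by
  obtain ⟨L, Q, ⟨hL, hL0, hQ, rfl⟩, -, p, hp0, hQp, -, c, hc, hLc⟩ := h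
  obtain ⟨l, hl⟩ := exists_dual hL
  obtain ⟨q, hq, hqt⟩ := exists_quadraticForm hQ
  have hlp : ∀ x, l x = c * QuadraticMap.polar q p x := by
    intro x
    rw [← hl, hLc, map_mul, eval_C, hqt]
  have hqp : q p = 0 := by rw [← hq, hQp]
  have hl0 : l ≠ 0 := by
    rintro rfl
    exact hL0 (MvPolynomial.funext fun x => by simp [hl])
  obtain ⟨ℓ, hℓ⟩ := exists_cubes_of_isotropic_pole hn (by simp) q hl0 hp0 hqp
    (by rw [hlp, QuadraticMap.polar_self, hqp]; simp) (by
      intro x hx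
      rw [hlp] at hx
      rw [QuadraticMap.polar_comm]
      exact (mul_eq_zero.1 hx).resolve_left hc)
  refine (waringRank_le_card ℓ 3 fun x => ?_).trans ?_
  · rw [map_mul, hl, hq, hℓ]
  · refine Nat.cast_le.2 ?_
    simp only [Fintype.card_sum, Fintype.card_prod, Fintype.card_fin, Fintype.card_bool]
    omega

end Polynomials

end ReducibleCubic

theorem theorem2 {K : Type*} [Field K] [IsAlgClosed K] [CharZero K] (n : ℕ) (hn : 1 ≤ n)
    (F : MvPolynomial (Fin (n + 1)) K) :
    (ReducibleCubic.IsTypeA F → ReducibleCubic.waringRank 3 F = ((2 * n : ℕ) : ℕ∞)) ∧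
    (2 ≤ n → ReducibleCubic.IsTypeB F →
      ReducibleCubic.waringRank 3 F = ((2 * n : ℕ) : ℕ∞)) ∧
    (ReducibleCubic.IsTypeC F →
      ((2 * n : ℕ) : ℕ∞) ≤ ReducibleCubic.waringRank 3 F ∧
      ReducibleCubic.waringRank 3 F ≤ ((2 * n + 1 : ℕ) : ℕ∞)) := by
  refine ⟨fun h => le_antisymm (ReducibleCubic.waringRank_le_of_typeA hn h) ?_,
    fun hn2 h => le_antisymm (ReducibleCubic.waringRank_le_of_typeB hn2 h) ?_,
    fun h => ⟨?_, ReducibleCubic.waringRank_le_of_typeC hn h⟩⟩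
  · obtain ⟨L, Q, hF, hQ, -⟩ := h
    exact ReducibleCubic.two_mul_le_waringRank hn hF fun v hv => (hQ ⟨v, hv⟩).elim
  · obtain ⟨L, Q, hF, -, hv⟩ := h
    exact ReducibleCubic.two_mul_le_waringRank hn hF hv
  · obtain ⟨L, Q, hF, hQ, -⟩ := h
    exact ReducibleCubic.two_mul_le_waringRank hn hF fun v hv => (hQ ⟨v, hv⟩).elim
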